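/- Let $p\in(0,1]$. Consider the random multigraph process $(G_t)_{t\ge 0}$ (loops and parallel edges allowed, a loop contributing $2$ to the degree of its vertex) defined as follows. $G_0$ is the graph with one vertex and one loop. Given $G_0,\dots,G_t$, a coin that is independent of the past and shows heads with probability $p$ is tossed. If it shows heads, a vertex-step is performed: $G_{t+1}$ arises from $G_t$ by adding a new vertex $v$ and an edge $\{u,v\}$, where $u$ is a vertex of $G_t$ chosen with probability proportional to its degree in $G_t$. If it shows tails, an edge-step is performed: $G_{t+1}$ arises from $G_t$ by adding a new edge $\{u_1,u_2\}$, where $u_1,u_2$ are vertices of $G_t$ chosen independently of each other, each with probability proportional to its degree in $G_t$ (so $u_1=u_2$ is possible, and so is a further edge between vertices that are already joined). Then for every $\varepsilon>0$, asymptotically almost surely, $G_{2t}$ has a complete subgraph of order $\bigl\lceil t^{(1-\varepsilon)\frac{1-p}{2-p}}\bigr\rceil$; that is, the probability that $G_{2t}$ has $\bigl\lceil t^{(1-\varepsilon)\frac{1-p}{2-p}}\bigr\rceil$ vertices, any two distinct ones of which are joined by at least one edge, tends to $1$ as the integer $t$ tends to infinity. -/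

import Mathlib

open MeasureTheory ProbabilityTheory Filter Topology
open scoped ENNReal

noncomputable section

/-- A finite multigraph (loops and parallel edges allowed) with at least one edge.  Its vertices are
`0, 1, …, order - 1`, numbered in the order in which they are added by the process. -/
@[ext]
structure Multigraph where
  /-- the number of vertices -/
  order : ℕ
  /-- the edges, with multiplicity; a loop at `v` is `s(v, v)` -/
  edges : Multiset (Sym2 ℕ)
  /-- endpoints of edges are vertices -/
  lt_order : ∀ e ∈ edges, ∀ v ∈ e, v < order
  /-- there is at least one edge, so that a vertex can be drawn proportionally to the degrees -/
  edges_ne_zero : edges ≠ 0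

namespace Multigraph

instance : MeasurableSpace Multigraph := ⊤

instance : DiscreteMeasurableSpace Multigraph := ⟨fun _ => trivial⟩

/-- The degree of `v`: the number of edge-ends at `v`, so that a loop counts twice. -/
def degree (G : Multigraph) (v : ℕ) : ℕ :=
  (G.edges.map fun e => e.toMultiset.count v).sum

/-- Some vertex has positive degree. -/
theorem exists_degree_ne_zero (G : Multigraph) : ∃ v : Fin G.order, G.degree v ≠ 0 := by
  obtain ⟨e, he⟩ := Multiset.exists_mem_of_ne_zero G.edges_ne_zero
  obtain ⟨v, hv⟩ : ∃ v, v ∈ e := ⟨_, e.out_fst_mem⟩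
  refine ⟨⟨v, G.lt_order e he v hv⟩, ?_⟩
  have h1 : 0 < e.toMultiset.count v :=
    Multiset.count_pos.2 (Sym2.mem_toMultiset.2 hv)
  have h2 : e.toMultiset.count v ≤ (G.edges.map fun e => e.toMultiset.count v).sum :=
    Multiset.single_le_sum (fun _ _ => Nat.zero_le _) _ (Multiset.mem_map_of_mem _ he)
  simp only [degree]
  omega

/-- A random vertex of `G`, drawn with probability proportional to its degree. -/
def randomVertex (G : Multigraph) : PMF (Fin G.order) :=
  PMF.normalize (fun v => (G.degree v : ℝ≥0∞))
    (by
      obtain ⟨v, hv⟩ := G.exists_degree_ne_zero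
      exact fun h => hv (by exact_mod_cast ENNReal.tsum_eq_zero.1 h v))
    (by
      rw [tsum_fintype]
      exact ENNReal.sum_ne_top.2 fun v _ => ENNReal.natCast_ne_top _)

/-- Add a new vertex to `G`, joined by one edge to the vertex `u` of `G`. -/
def addVertex (G : Multigraph) (u : Fin G.order) : Multigraph where
  order := G.order + 1
  edges := s((u : ℕ), G.order) ::ₘ G.edges
  lt_order := by
    intro e he v hv
    rcases Multiset.mem_cons.1 he with rfl | he
    · rcases Sym2.mem_iff.1 hv with rfl | rfl <;> omega
    · exact (G.lt_order e he v hv).trans (Nat.lt_succ_self _)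
  edges_ne_zero := Multiset.cons_ne_zero

/-- Add to `G` a new edge (possibly a loop or a parallel edge) between its vertices `u` and `w`. -/
def addEdge (G : Multigraph) (u w : Fin G.order) : Multigraph where
  order := G.order
  edges := s((u : ℕ), (w : ℕ)) ::ₘ G.edges
  lt_order := by
    intro e he v hv
    rcases Multiset.mem_cons.1 he with rfl | he
    · rcases Sym2.mem_iff.1 hv with rfl | rfl <;> omega
    · exact G.lt_order e he v hv
  edges_ne_zero := Multiset.cons_ne_zero

/-- The graph with one vertex and one loop. -/
def initial : Multigraph where
  order := 1
  edges := {s(0, 0)}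
  lt_order := by
    intro e he v hv
    rw [Multiset.mem_singleton] at he
    subst he
    rcases Sym2.mem_iff.1 hv with rfl | rfl <;> omega
  edges_ne_zero := Multiset.singleton_ne_zero _

/-- The vertex-step: a new vertex is joined to a random vertex of `G`. -/
def vertexStep (G : Multigraph) : PMF Multigraph :=
  G.randomVertex.bind fun u => PMF.pure (G.addVertex u)

/-- The edge-step: a new edge joins two independent random vertices of `G`. -/
def edgeStep (G : Multigraph) : PMF Multigraph :=
  G.randomVertex.bind fun u => G.randomVertex.bind fun w => PMF.pure (G.addEdge u w)

/-- The simple graph underlying `G`: distinct vertices joined by at least one edge are adjacent. -/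
def toSimpleGraph (G : Multigraph) : SimpleGraph (Fin G.order) where
  Adj u v := u ≠ v ∧ s((u : ℕ), (v : ℕ)) ∈ G.edges
  symm := ⟨fun _ _ h => ⟨h.1.symm, Sym2.eq_swap ▸ h.2⟩⟩
  loopless := ⟨fun _ h => h.1 rfl⟩

/-- `G` has a complete subgraph on exactly `k` vertices. -/
def HasCompleteSubgraph (G : Multigraph) (k : ℕ) : Prop :=
  ∃ S : Finset (Fin G.order), G.toSimpleGraph.IsNClique k S

end Multigraph

/-- The Bernoulli distribution with parameter `p`; `true` has probability `p`. -/
def coin (p : unitInterval) : PMF Bool :=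
  PMF.ofFintype (fun b => ENNReal.ofReal (if b then (p : ℝ) else 1 - p)) (by
    rw [Fintype.sum_bool, if_pos rfl, if_neg Bool.false_ne_true,
      ← ENNReal.ofReal_add p.2.1 (sub_nonneg.2 p.2.2)]
    simp)

/-- The conditional law of `G_{t+1}` given `G_t = G`: a fresh coin with parameter `p` decides
whether a vertex-step or an edge-step is performed. -/
def glpStep (p : unitInterval) (G : Multigraph) : PMF Multigraph :=
  (coin p).bind fun z => if z then G.vertexStep else G.edgeStep

/-- The transition kernel of the process. -/
def glpKernel (p : unitInterval) : Kernel Multigraph Multigraph where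
  toFun G := (glpStep p G).toMeasure
  measurable' := measurable_from_top

instance (p : unitInterval) : IsMarkovKernel (glpKernel p) :=
  ⟨fun G => inferInstanceAs (IsProbabilityMeasure (glpStep p G).toMeasure)⟩

/-- The law of the whole process `(G_t)_{t ≥ 0}`, a probability measure on sequences of multigraphs:
`G_0` is the graph with one vertex and one loop and, given `G_0, …, G_t`, the law of
`G_{t+1}` is `glpStep p G_t`. -/
def glpLaw (p : unitInterval) : Measure (ℕ → Multigraph) :=
  Kernel.trajMeasure (X := fun _ => Multigraph) (Measure.dirac Multigraph.initial) fun t =>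
    (glpKernel p).comap (fun G : (i : Finset.Iic t) → Multigraph => G ⟨t, Finset.mem_Iic.2 le_rfl⟩)
      (measurable_pi_apply _)

end

/-!
The argument splits the `2t` steps at the times `s = ⌊t ^ σ⌋` and `t`; `K = ⌈t ^ κ⌉` is the order of
the clique, where `κ = (1 - ε) (1 - p) / (2 - p)` and `σ = (1 - ε / 2) (1 - p) / (2 - p)`, so that `s`
is much larger than `K`.

* Up to time `s`: the number of vertices grows linearly, and `E[2 ^ (-order)]` is multiplied by
  `1 - p / 2` in every step. By Markov's inequality there are at least `2 K` vertices at time `s`,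
  up to an error `4 ^ K (1 - p / 2) ^ s` (`iterMean_initial_le`).
* From `s` to `t`: a degree is expected to grow like `m ^ ((2 - p) / 2)` in the number `m` of edges,
  hence by a factor of about `(t / s) ^ ((2 - p) / 2) ≫ t ^ (1 / 2)`. What is needed is a lower tail
  bound, and for this `(deg v - 3 / 4) ^ (-1 / 2) * m ^ ((2 - p) / 4)` is a supermartingale
  (`stepMean_potential_le`). Summed over the first `2 K` vertices it shows that with high probability
  at least `K` of them have degree at least `x = t ^ (1 / 2 + δ)` at time `t`
  (`iterMean_le_of_many_large_degrees`). A union bound over vertices would be too weak here: the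
  failure probability of one vertex decays only like a small power of `t`, so it is the *number* of
  failing vertices that is estimated.
* From `t` to `2 t`: each step joins two given vertices of degree at least `x` with probability at
  least `(1 - p) (x / (4 t)) ^ 2`, of order `t ^ (2 δ - 1)`. In `t` steps all pairs among the `K` large
  vertices are joined, up to a stretched exponential error (`iterMean_noClique_le`).

All expectations are finite sums of real numbers: `stepMean` and `iterMean` are the transition
operator and its powers, `lintegral_glpLaw` identifies them with integrals against the law of the
process, and the three phases are three uses of one comparison principle, `iterMean_le`. If
`κ ≤ 0` (in particular if `p = 1` or `1 ≤ ε`), the clique has order `1` and there is nothing to do.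
-/

/-! ### Degrees and the random vertex -/

namespace Multigraph

theorem count_toMultiset_mk (u w v : ℕ) :
    s(u, w).toMultiset.count v = (if u = v then 1 else 0) + if w = v then 1 else 0 := by
  change Multiset.count v (u ::ₘ w ::ₘ 0) = _
  simp only [Multiset.count_cons, Multiset.count_zero, eq_comm (a := v)]
  omega

theorem degree_addVertex (G : Multigraph) (u : Fin G.order) (v : ℕ) :
    (G.addVertex u).degree v =
      G.degree v + ((if (u : ℕ) = v then 1 else 0) + if G.order = v then 1 else 0) := by
  simp only [degree, addVertex, Multiset.map_cons, Multiset.sum_cons, count_toMultiset_mk]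
  exact add_comm _ _

theorem degree_addEdge (G : Multigraph) (u w : Fin G.order) (v : ℕ) :
    (G.addEdge u w).degree v =
      G.degree v + ((if (u : ℕ) = v then 1 else 0) + if (w : ℕ) = v then 1 else 0) := by
  simp only [degree, addEdge, Multiset.map_cons, Multiset.sum_cons, count_toMultiset_mk]
  exact add_comm _ _

/-- The handshake lemma, with loops counted twice. -/
theorem sum_degree (G : Multigraph) : ∑ v : Fin G.order, G.degree v = 2 * G.edges.card := by
  have key : ∀ E : Multiset (Sym2 ℕ), (∀ e ∈ E, ∀ v ∈ e, v < G.order) →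
      ∑ v : Fin G.order, (E.map fun e => e.toMultiset.count (v : ℕ)).sum = 2 * E.card := by
    intro E
    induction E using Multiset.induction_on with
    | empty => simp
    | cons e E ih =>
      intro h
      simp only [Multiset.map_cons, Multiset.sum_cons, Finset.sum_add_distrib, Multiset.card_cons]
      rw [ih fun e' he' => h e' (Multiset.mem_cons_of_mem he')]
      have he := h e (Multiset.mem_cons_self _ _)
      rw [Fin.sum_univ_eq_sum_range fun v => e.toMultiset.count v,
        Multiset.sum_count_eq_card fun v hv => Finset.mem_range.2 (he v (Sym2.mem_toMultiset.1 hv)),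
        Sym2.card_toMultiset]
      ring
  exact key G.edges G.lt_order

/-- The probability that the random vertex of `G` is `v`, as a real number. -/
noncomputable def weight (G : Multigraph) (v : ℕ) : ℝ := G.degree v / (2 * G.edges.card)

theorem card_edges_pos (G : Multigraph) : 0 < G.edges.card :=
  Multiset.card_pos.2 G.edges_ne_zero

theorem weight_nonneg (G : Multigraph) (v : ℕ) : 0 ≤ G.weight v := by
  unfold weight; positivity

theorem sum_weight (G : Multigraph) : ∑ v : Fin G.order, G.weight v = 1 := by
  have h : (0 : ℝ) < G.edges.card := by exact_mod_cast G.card_edges_pos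
  simp only [weight]
  rw [← Finset.sum_div, ← Nat.cast_sum, G.sum_degree]
  push_cast
  exact div_self (by positivity)

theorem randomVertex_apply (G : Multigraph) (v : Fin G.order) :
    G.randomVertex v = ENNReal.ofReal (G.weight v) := by
  have h : (0 : ℝ) < G.edges.card := by exact_mod_cast G.card_edges_pos
  rw [randomVertex, PMF.normalize_apply, tsum_fintype, ← Nat.cast_sum, G.sum_degree, weight,
    ENNReal.ofReal_div_of_pos (by positivity), ENNReal.ofReal_natCast, div_eq_mul_inv]
  congr 2
  rw [← ENNReal.ofReal_natCast]
  push_cast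
  rfl

theorem sum_weight_mul_ite (G : Multigraph) {v : ℕ} (hv : v < G.order) (a b : ℝ) :
    ∑ u : Fin G.order, G.weight u * (if (u : ℕ) = v then a else b) =
      G.weight v * a + (1 - G.weight v) * b := by
  have h1 : ∀ u : Fin G.order, G.weight u * (if (u : ℕ) = v then a else b) =
      G.weight u * b + if u = ⟨v, hv⟩ then G.weight v * (a - b) else 0 := by
    intro u
    by_cases h : (u : ℕ) = v
    · rw [if_pos h, if_pos (Fin.ext h), h]; ring
    · rw [if_neg h, if_neg fun h' => h (congrArg Fin.val h')]; ring
  simp only [h1, Finset.sum_add_distrib, ← Finset.sum_mul, G.sum_weight, Finset.sum_ite_eq',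
    Finset.mem_univ, if_true]
  ring

end Multigraph

/-! ### The transition operator and the law of the process -/

/-- The expectation of `f (G_{t+1})` given `G_t = G`, as a finite sum. -/
noncomputable def stepMean (p : ℝ) (f : Multigraph → ℝ) (G : Multigraph) : ℝ :=
  p * ∑ u : Fin G.order, G.weight u * f (G.addVertex u) +
    (1 - p) * ∑ u : Fin G.order, G.weight u * ∑ w : Fin G.order, G.weight w * f (G.addEdge u w)

/-- The expectation of `f (G_{t+n})` given `G_t = G`: the `n`-th power of the transition operator. -/
noncomputable def iterMean (p : ℝ) : ℕ → (Multigraph → ℝ) → Multigraph → ℝ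
  | 0, f => f
  | n + 1, f => iterMean p n (stepMean p f)

theorem stepMean_nonneg (p : unitInterval) {f : Multigraph → ℝ} (hf : ∀ G, 0 ≤ f G)
    (G : Multigraph) : 0 ≤ stepMean p f G := by
  have h1 : (0 : ℝ) ≤ p := p.2.1
  have h2 : (0 : ℝ) ≤ 1 - p := sub_nonneg.2 p.2.2
  unfold stepMean
  have := G.weight_nonneg
  exact add_nonneg
    (mul_nonneg h1 (Finset.sum_nonneg fun u _ => mul_nonneg (this _) (hf _)))
    (mul_nonneg h2 (Finset.sum_nonneg fun u _ => mul_nonneg (this _)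
      (Finset.sum_nonneg fun w _ => mul_nonneg (this _) (hf _))))

theorem lintegral_toMeasure_bind {α β : Type*} [Fintype α] [MeasurableSpace β]
    (μ : PMF α) (f : α → PMF β) (h : β → ℝ≥0∞) :
    ∫⁻ b, h b ∂(μ.bind f).toMeasure = ∑ a, μ a * ∫⁻ b, h b ∂(f a).toMeasure := by
  have : (μ.bind f).toMeasure = ∑ a, μ a • (f a).toMeasure := by
    ext s hs
    rw [PMF.toMeasure_bind_apply _ _ _ hs, tsum_fintype]
    simp
  rw [this, lintegral_finsetSum_measure]
  simp [lintegral_smul_measure]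

theorem lintegral_glpStep (p : unitInterval) {f : Multigraph → ℝ} (hf : ∀ G, 0 ≤ f G)
    (G : Multigraph) :
    ∫⁻ H, ENNReal.ofReal (f H) ∂(glpStep p G).toMeasure = ENNReal.ofReal (stepMean p f G) := by
  have h1 : (0 : ℝ) ≤ p := p.2.1
  have h2 : (0 : ℝ) ≤ 1 - p := sub_nonneg.2 p.2.2
  have hw := G.weight_nonneg
  have h3 : ∀ u : Fin G.order, 0 ≤ ∑ w : Fin G.order, G.weight w * f (G.addEdge u w) :=
    fun u => Finset.sum_nonneg fun w _ => mul_nonneg (hw _) (hf _)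
  rw [glpStep, lintegral_toMeasure_bind, Fintype.sum_bool]
  simp only [if_true, Bool.false_eq_true, if_false, Multigraph.vertexStep, Multigraph.edgeStep,
    lintegral_toMeasure_bind, PMF.toMeasure_pure, lintegral_dirac, Multigraph.randomVertex_apply,
    coin, PMF.ofFintype_apply]
  rw [stepMean, ENNReal.ofReal_add
      (mul_nonneg h1 (Finset.sum_nonneg fun u _ => mul_nonneg (hw _) (hf _)))
      (mul_nonneg h2 (Finset.sum_nonneg fun u _ => mul_nonneg (hw _) (h3 u))),
    ENNReal.ofReal_mul h1, ENNReal.ofReal_mul h2,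
    ENNReal.ofReal_sum_of_nonneg fun u _ => mul_nonneg (hw _) (hf _),
    ENNReal.ofReal_sum_of_nonneg fun u _ => mul_nonneg (hw _) (h3 u)]
  congr 2
  · exact Finset.sum_congr rfl fun u _ => (ENNReal.ofReal_mul (hw _)).symm
  · refine Finset.sum_congr rfl fun u _ => ?_
    rw [ENNReal.ofReal_mul (hw _),
      ENNReal.ofReal_sum_of_nonneg fun w _ => mul_nonneg (hw _) (hf _)]
    congr 1
    exact Finset.sum_congr rfl fun w _ => (ENNReal.ofReal_mul (hw _)).symm

instance isProbabilityMeasure_glpLaw (p : unitInterval) : IsProbabilityMeasure (glpLaw p) := by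
  unfold glpLaw; infer_instance

theorem lintegral_glpLaw_zero (p : unitInterval) (h : Multigraph → ℝ≥0∞) :
    ∫⁻ G, h (G 0) ∂glpLaw p = h Multigraph.initial := by
  have hm : Measurable h := measurable_from_top
  have h0 : Measurable fun G : ℕ → Multigraph => h (G 0) := hm.comp (measurable_pi_apply 0)
  rw [glpLaw, Kernel.trajMeasure, Measure.lintegral_bind (Kernel.aemeasurable _) h0.aemeasurable]
  refine (lintegral_map (Measurable.lintegral_kernel h0)
    (MeasurableEquiv.measurable _)).trans ?_
  rw [lintegral_dirac, Kernel.lintegral_traj _ h0]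
  simp only [Function.updateFinset, Finset.mem_Iic, le_refl, dite_true]
  rw [lintegral_const, measure_univ, mul_one]
  rfl

/-- The Markov property, in the form of the recursion for the marginals. -/
theorem lintegral_glpLaw_succ (p : unitInterval) (h : Multigraph → ℝ≥0∞) (n : ℕ) :
    ∫⁻ G, h (G (n + 1)) ∂glpLaw p = ∫⁻ G, ∫⁻ H, h H ∂(glpStep p (G n)).toMeasure ∂glpLaw p := by
  have hm : Measurable h := measurable_from_top
  have key := Kernel.map_frestrictLe_trajMeasure_compProd_eq_map_trajMeasure
    (X := fun _ => Multigraph) (μ₀ := Measure.dirac Multigraph.initial)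
    (κ := fun t => (glpKernel p).comap
      (fun G : (i : Finset.Iic t) → Multigraph => G ⟨t, Finset.mem_Iic.2 le_rfl⟩)
      (measurable_pi_apply _)) (a := n)
  have hs : Measurable fun x : ((i : Finset.Iic n) → Multigraph) × Multigraph => h x.2 :=
    hm.comp measurable_snd
  have hk : Measurable fun H : Multigraph => ∫⁻ H', h H' ∂(glpStep p H).toMeasure :=
    measurable_from_top
  have e := congrArg
    (fun μ : Measure (((i : Finset.Iic n) → Multigraph) × Multigraph) => ∫⁻ x, h x.2 ∂μ) key
  beta_reduce at e
  rw [Measure.lintegral_compProd hs, lintegral_map hs (by fun_prop),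
    lintegral_map (Measurable.lintegral_kernel (f := fun x => h x) hm) (by fun_prop)] at e
  exact e.symm

/-- Expectations of nonnegative functions of `G_n` are given by the powers of the transition operator
at the initial graph. -/
theorem lintegral_glpLaw (p : unitInterval) (n : ℕ) {f : Multigraph → ℝ} (hf : ∀ G, 0 ≤ f G) :
    ∫⁻ G, ENNReal.ofReal (f (G n)) ∂glpLaw p =
      ENNReal.ofReal (iterMean p n f Multigraph.initial) := by
  induction n generalizing f with
  | zero => exact lintegral_glpLaw_zero p fun G => ENNReal.ofReal (f G)
  | succ n ih =>
    rw [lintegral_glpLaw_succ p fun G => ENNReal.ofReal (f G)]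
    simp only [lintegral_glpStep p hf]
    exact ih (stepMean_nonneg p hf)

/-! ### The comparison principle -/

theorem stepMean_mono (p : unitInterval) {f g : Multigraph → ℝ} {G : Multigraph}
    (hv : ∀ u, f (G.addVertex u) ≤ g (G.addVertex u))
    (he : ∀ u w, f (G.addEdge u w) ≤ g (G.addEdge u w)) : stepMean p f G ≤ stepMean p g G := by
  have h1 : (0 : ℝ) ≤ p := p.2.1
  have h2 : (0 : ℝ) ≤ 1 - p := sub_nonneg.2 p.2.2
  have hw := G.weight_nonneg
  unfold stepMean
  gcongr with u _ u _ w _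
  · exact hw _
  · exact hv u
  · exact hw _
  · exact hw _
  · exact he u w

theorem stepMean_const (p c : ℝ) (G : Multigraph) : stepMean p (fun _ => c) G = c := by
  simp only [stepMean, ← Finset.sum_mul, G.sum_weight]
  ring

theorem stepMean_add (p : ℝ) (f g : Multigraph → ℝ) (G : Multigraph) :
    stepMean p (fun H => f H + g H) G = stepMean p f G + stepMean p g G := by
  simp only [stepMean, mul_add, Finset.sum_add_distrib]
  ring

theorem stepMean_const_mul (p c : ℝ) (f : Multigraph → ℝ) (G : Multigraph) :
    stepMean p (fun H => c * f H) G = c * stepMean p f G := by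
  simp only [stepMean, mul_left_comm _ c, ← Finset.mul_sum]
  ring

theorem stepMean_sum {ι : Type*} (p : ℝ) (s : Finset ι) (f : ι → Multigraph → ℝ)
    (G : Multigraph) : stepMean p (fun H => ∑ i ∈ s, f i H) G = ∑ i ∈ s, stepMean p (f i) G := by
  classical
  induction s using Finset.induction_on with
  | empty => simpa using stepMean_const p 0 G
  | insert a s ha ih => simp only [Finset.sum_insert ha, stepMean_add, ih]

theorem iterMean_add (p : ℝ) (m n : ℕ) (f : Multigraph → ℝ) :
    iterMean p (m + n) f = iterMean p m (iterMean p n f) := by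
  induction n generalizing f with
  | zero => rfl
  | succ n ih => exact ih _

/-- The comparison principle: if `F` is a supermartingale as long as the invariant `I` holds, and
dominates `f` at time `n`, then `F 0` dominates the expectation of `f` at time `n`. The invariant,
like `F`, may depend on time, and every possible step preserves it. -/
theorem iterMean_le (p : unitInterval) (I : ℕ → Multigraph → Prop) (F : ℕ → Multigraph → ℝ)
    (n : ℕ) {f : Multigraph → ℝ}
    (hv : ∀ k < n, ∀ G, I k G → ∀ u, I (k + 1) (G.addVertex u))
    (he : ∀ k < n, ∀ G, I k G → ∀ u w, I (k + 1) (G.addEdge u w))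
    (hF : ∀ k < n, ∀ G, I k G → stepMean p (F (k + 1)) G ≤ F k G)
    (hf : ∀ G, I n G → f G ≤ F n G) {G : Multigraph} (hG : I 0 G) :
    iterMean p n f G ≤ F 0 G := by
  induction n generalizing f with
  | zero => exact hf G hG
  | succ n ih =>
    refine ih (fun k hk => hv k (by omega)) (fun k hk => he k (by omega))
      (fun k hk => hF k (by omega)) fun H hH => ?_
    exact (stepMean_mono p (fun u => hf _ (hv n (by omega) H hH u))
      fun u w => hf _ (he n (by omega) H hH u w)).trans (hF n (by omega) H hH)

theorem iterMean_nonneg (p : unitInterval) (n : ℕ) {f : Multigraph → ℝ} (hf : ∀ G, 0 ≤ f G)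
    (G : Multigraph) : 0 ≤ iterMean p n f G := by
  induction n generalizing f with
  | zero => exact hf G
  | succ n ih => exact ih (stepMean_nonneg p hf)

theorem iterMean_le_const (p : unitInterval) (n : ℕ) {f : Multigraph → ℝ} {c : ℝ}
    (hf : ∀ G, f G ≤ c) (G : Multigraph) : iterMean p n f G ≤ c :=
  iterMean_le p (fun _ _ => True) (fun _ _ => c) n (fun _ _ _ _ _ => trivial)
    (fun _ _ _ _ _ _ => trivial) (fun _ _ _ _ => (stepMean_const _ _ _).le) (fun G _ => hf G)
    trivial

/-! ### Behaviour of order, size and degrees in one step -/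

namespace Multigraph

theorem card_edges_addVertex (G : Multigraph) (u : Fin G.order) :
    (G.addVertex u).edges.card = G.edges.card + 1 := Multiset.card_cons _ _

theorem card_edges_addEdge (G : Multigraph) (u w : Fin G.order) :
    (G.addEdge u w).edges.card = G.edges.card + 1 := Multiset.card_cons _ _

theorem order_addVertex (G : Multigraph) (u : Fin G.order) :
    (G.addVertex u).order = G.order + 1 := rfl

theorem order_addEdge (G : Multigraph) (u w : Fin G.order) :
    (G.addEdge u w).order = G.order := rfl

/-- Every vertex is an endpoint of some edge. -/
def NoIsolated (G : Multigraph) : Prop := ∀ v < G.order, 1 ≤ G.degree v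

theorem NoIsolated.addVertex {G : Multigraph} (h : G.NoIsolated) (u : Fin G.order) :
    (G.addVertex u).NoIsolated := by
  intro v hv
  rw [order_addVertex] at hv
  rw [degree_addVertex]
  by_cases hv' : v < G.order
  · have := h v hv'; omega
  · rw [if_pos (show G.order = v by omega)]; omega

theorem NoIsolated.addEdge {G : Multigraph} (h : G.NoIsolated) (u w : Fin G.order) :
    (G.addEdge u w).NoIsolated := by
  intro v hv
  have := h v hv
  rw [degree_addEdge]
  omega

theorem noIsolated_initial : initial.NoIsolated := by
  intro v hv
  obtain rfl : v = 0 := by simpa [initial] using hv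
  simp [degree, initial, count_toMultiset_mk]

theorem degree_le (G : Multigraph) {v : ℕ} (hv : v < G.order) :
    G.degree v ≤ 2 * G.edges.card := by
  rw [← G.sum_degree]
  exact Finset.single_le_sum (f := fun v : Fin G.order => G.degree v) (fun _ _ => Nat.zero_le _)
    (Finset.mem_univ ⟨v, hv⟩)

end Multigraph

/-! ### The number of vertices grows linearly -/

theorem stepMean_half_pow_order (p : ℝ) (G : Multigraph) :
    stepMean p (fun H => (1 / 2 : ℝ) ^ H.order) G = (1 - p / 2) * (1 / 2) ^ G.order := by
  simp only [stepMean, Multigraph.order_addVertex, Multigraph.order_addEdge, ← Finset.sum_mul,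
    G.sum_weight]
  ring

/-- Up to the error `2 ^ M * (1 - p / 2) ^ n`, the graph has at least `M` vertices at time `n`. Here
`f ≤ 1` stands for the conditional probability of failure in what follows. -/
theorem iterMean_initial_le (p : unitInterval) (n M : ℕ) {f : Multigraph → ℝ} {b : ℝ} (hb : 0 ≤ b)
    (hf1 : ∀ G, f G ≤ 1)
    (hf : ∀ G : Multigraph, G.NoIsolated → G.edges.card = n + 1 → M ≤ G.order → f G ≤ b) :
    iterMean p n f Multigraph.initial ≤ b + 2 ^ M * (1 - p / 2) ^ n := by
  have h1 : (p : ℝ) ≤ 1 := p.2.2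
  have h2 : (0 : ℝ) ≤ (1 - p / 2) ^ n := pow_nonneg (by linarith) _
  have key := iterMean_le p (fun k G => G.NoIsolated ∧ G.edges.card = k + 1)
    (fun k G => b + 2 ^ M * (1 - p / 2 : ℝ) ^ (n - k) * (1 / 2 : ℝ) ^ G.order) n (f := f)
    (fun k _ G hG u => ⟨hG.1.addVertex u, by rw [G.card_edges_addVertex, hG.2]⟩)
    (fun k _ G hG u w => ⟨hG.1.addEdge u w, by rw [G.card_edges_addEdge, hG.2]⟩)
    (fun k hk G _ => by
      rw [stepMean_add, stepMean_const, stepMean_const_mul, stepMean_half_pow_order,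
        show n - k = n - (k + 1) + 1 by omega, pow_succ]
      apply le_of_eq
      ring)
    (fun G hG => by
      by_cases hM : M ≤ G.order
      · have : (0 : ℝ) ≤ 2 ^ M * (1 - p / 2 : ℝ) ^ (n - n) * (1 / 2 : ℝ) ^ G.order := by
          rw [Nat.sub_self]; positivity
        linarith [hf G hG.1 hG.2 hM]
      · have h3 : (2 : ℝ) ^ G.order ≤ 2 ^ M := pow_le_pow_right₀ (by norm_num) (by omega)
        have h4 : 1 ≤ (2 : ℝ) ^ M * (1 / 2) ^ G.order := by
          rw [one_div, inv_pow, ← div_eq_mul_inv, one_le_div (by positivity)]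
          exact h3
        rw [Nat.sub_self, pow_zero, mul_one]
        linarith [hf1 G])
    (G := Multigraph.initial) ⟨Multigraph.noIsolated_initial, rfl⟩
  refine key.trans ?_
  rw [Nat.sub_zero]
  have h5 : (1 / 2 : ℝ) ^ Multigraph.initial.order ≤ 1 := pow_le_one₀ (by norm_num) (by norm_num)
  have := mul_le_mul_of_nonneg_left h5 (show (0 : ℝ) ≤ 2 ^ M * (1 - p / 2) ^ n by positivity)
  linarith

/-! ### A supermartingale that controls small degrees -/

/-- An edge-step draws two independent endpoints, so it raises the degree of `v` by a binomial number,
a loop at `v` by `2`. -/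
theorem stepMean_degree (p : ℝ) (g : ℕ → ℝ) (A : ℕ → ℝ) {G : Multigraph} {v : ℕ}
    (hv : v < G.order) :
    stepMean p (fun H => g (H.degree v) * A H.edges.card) G =
      (p * (G.weight v * g (G.degree v + 1) + (1 - G.weight v) * g (G.degree v)) +
        (1 - p) * (G.weight v * (G.weight v * g (G.degree v + 2) +
            (1 - G.weight v) * g (G.degree v + 1)) +
          (1 - G.weight v) * (G.weight v * g (G.degree v + 1) +
            (1 - G.weight v) * g (G.degree v)))) * A (G.edges.card + 1) := by
  have h1 : ∀ u : Fin G.order, g ((G.addVertex u).degree v) * A (G.addVertex u).edges.card =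
      (if (u : ℕ) = v then g (G.degree v + 1) else g (G.degree v)) * A (G.edges.card + 1) := by
    intro u
    rw [G.degree_addVertex, if_neg (show G.order ≠ v by omega), G.card_edges_addVertex]
    split_ifs <;> simp
  have h2 : ∀ u w : Fin G.order, g ((G.addEdge u w).degree v) * A (G.addEdge u w).edges.card =
      (if (w : ℕ) = v then (if (u : ℕ) = v then g (G.degree v + 2) else g (G.degree v + 1))
        else (if (u : ℕ) = v then g (G.degree v + 1) else g (G.degree v))) *
        A (G.edges.card + 1) := by
    intro u w
    rw [G.degree_addEdge, G.card_edges_addEdge]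
    split_ifs <;> simp
  have h3 : ∑ u : Fin G.order, G.weight u *
      (g ((G.addVertex u).degree v) * A (G.addVertex u).edges.card) =
      (G.weight v * g (G.degree v + 1) + (1 - G.weight v) * g (G.degree v)) *
        A (G.edges.card + 1) := by
    simp only [h1, ← mul_assoc, ← Finset.sum_mul, G.sum_weight_mul_ite hv]
  have h4 : ∀ u : Fin G.order, ∑ w : Fin G.order, G.weight w *
      (g ((G.addEdge u w).degree v) * A (G.addEdge u w).edges.card) =
      (if (u : ℕ) = v
        then G.weight v * g (G.degree v + 2) + (1 - G.weight v) * g (G.degree v + 1)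
        else G.weight v * g (G.degree v + 1) + (1 - G.weight v) * g (G.degree v)) *
        A (G.edges.card + 1) := by
    intro u
    simp only [h2, ← mul_assoc, ← Finset.sum_mul, G.sum_weight_mul_ite hv]
    split_ifs <;> rfl
  simp only [stepMean, h3, h4]
  simp only [← mul_assoc, ← Finset.sum_mul, G.sum_weight_mul_ite hv]
  ring

/-- `(d - 3 / 4) ^ (-1 / 2)`, a decreasing function of the degree. The exponent makes it comparable to
`d ^ (-1 / 2)`; the shift `3 / 4` makes it drop by the full factor `1 - 1 / (2 d)` when `d` grows by
`1` (`potential_succ_le`), for which `d ^ (-1 / 2)` itself drops too slowly, while it stays finite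
at `d = 1`. -/
noncomputable def potential (d : ℕ) : ℝ := (√(d - 3 / 4))⁻¹

theorem potential_nonneg (d : ℕ) : 0 ≤ potential d := by unfold potential; positivity

theorem potential_le_two {d : ℕ} (hd : 1 ≤ d) : potential d ≤ 2 := by
  have hd' : (1 : ℝ) ≤ d := by exact_mod_cast hd
  unfold potential
  rw [inv_le_comm₀ (Real.sqrt_pos.2 (by linarith)) two_pos]
  apply Real.le_sqrt_of_sq_le
  norm_num; linarith

theorem inv_sqrt_le_potential {d : ℕ} (hd : 1 ≤ d) {x : ℝ} (hx : d ≤ x) :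
    (√x)⁻¹ ≤ potential d := by
  have hd' : (1 : ℝ) ≤ d := by exact_mod_cast hd
  unfold potential
  gcongr
  · exact Real.sqrt_pos.2 (by linarith)
  · linarith

theorem potential_succ_le {d : ℕ} (hd : 1 ≤ d) :
    potential (d + 1) ≤ potential d * (1 - 1 / (2 * d)) := by
  have hd' : (1 : ℝ) ≤ d := by exact_mod_cast hd
  have h0 : (0 : ℝ) < d - 3 / 4 := by linarith
  have h1 : (0 : ℝ) ≤ 1 - 1 / (2 * d) := by
    rw [sub_nonneg, div_le_one (by positivity)]; linarith
  have h2 : ((d : ℝ) - 3 / 4) ≤ (d + 1 - 3 / 4) * (1 - 1 / (2 * d)) ^ 2 := by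
    have : ((d : ℝ) + 1 - 3 / 4) * (1 - 1 / (2 * d)) ^ 2 - (d - 3 / 4) = 1 / (16 * d ^ 2) := by
      field_simp
      ring
    have h3 : (0 : ℝ) ≤ 1 / (16 * d ^ 2) := by positivity
    linarith
  have h4 := Real.sqrt_le_sqrt h2
  rw [Real.sqrt_mul (by linarith), Real.sqrt_sq h1] at h4
  have h5 : 0 < √((d : ℝ) - 3 / 4) := Real.sqrt_pos.2 h0
  have h6 : 0 < √((d : ℝ) + 1 - 3 / 4) := Real.sqrt_pos.2 (by linarith)
  unfold potential
  push_cast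
  rw [inv_mul_eq_div, le_div_iff₀ h5, inv_mul_le_iff₀ h6]
  exact h4

/-- With `A`, `B`, `C` the potentials of the degrees `d`, `d + 1`, `d + 2` in a graph with `m` edges,
the left-hand side is the expected potential after one step. -/
theorem one_step_factor_le {p d m A B C : ℝ} (hp0 : 0 ≤ p) (hp1 : p ≤ 1) (hd : 1 ≤ d)
    (hm : 0 < m) (hdm : d ≤ 2 * m) (hA : 0 ≤ A) (hBA : B ≤ A * (1 - 1 / (2 * d)))
    (hCB : C ≤ B * (1 - 1 / (2 * (d + 1)))) :
    p * (d / (2 * m) * B + (1 - d / (2 * m)) * A) +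
        (1 - p) * (d / (2 * m) * (d / (2 * m) * C + (1 - d / (2 * m)) * B) +
          (1 - d / (2 * m)) * (d / (2 * m) * B + (1 - d / (2 * m)) * A)) ≤
      A * (1 - (2 - p) / 4 / m + 3 * (1 - p) / (16 * m ^ 2)) := by
  -- In terms of `q = d / (2 m)`, the relative decrements `r`, `s` satisfy `q * r = e` and
  -- `q * s ≈ e`, so the factor is `p (1 - e) + (1 - p) (1 - e) ^ 2` up to an error `O (e ^ 2)`.
  obtain ⟨e, he⟩ : ∃ e : ℝ, e = 1 / (4 * m) := ⟨_, rfl⟩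
  obtain ⟨q, hq⟩ : ∃ q : ℝ, q = d / (2 * m) := ⟨_, rfl⟩
  obtain ⟨s, hs⟩ : ∃ s : ℝ, s = 1 / (2 * (d + 1)) := ⟨_, rfl⟩
  obtain ⟨r, hr⟩ : ∃ r : ℝ, r = 1 / (2 * d) := ⟨_, rfl⟩
  have he0 : 0 ≤ e := by rw [he]; positivity
  have hq0 : 0 ≤ q := by rw [hq]; positivity
  have hq1 : q ≤ 1 := by rw [hq, div_le_one (by positivity)]; exact hdm
  have hs0 : 0 ≤ s := by rw [hs]; positivity
  have hs1 : s ≤ 1 := by rw [hs, div_le_one (by positivity)]; linarith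
  have hqr : q * r = e := by rw [hq, hr, he]; field_simp; norm_num
  have hqs : q * s = e - e * (2 * s) := by rw [hq, hs, he]; field_simp; ring
  have hqe : q * (2 * s) ≤ 2 * e := by
    nlinarith [mul_nonneg he0 hs0]
  have hρ : 1 - (2 - p) / 4 / m + 3 * (1 - p) / (16 * m ^ 2) =
      1 - (2 - p) * e + 3 * (1 - p) * e ^ 2 := by rw [he]; field_simp; ring
  rw [hρ, ← hq]
  rw [← hr] at hBA
  rw [← hs] at hCB
  have hp1' : 0 ≤ 1 - p := by linarith
  have hq1' : 0 ≤ 1 - q := by linarith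
  have hs1' : 0 ≤ 1 - s := by linarith
  have h1 := mul_le_mul_of_nonneg_left hCB (show 0 ≤ (1 - p) * q ^ 2 by positivity)
  have h2 := mul_le_mul_of_nonneg_left hBA
    (show 0 ≤ p * q + 2 * (1 - p) * (q * (1 - q)) + (1 - p) * q ^ 2 * (1 - s) by positivity)
  have h3 : (1 - p) * (A * ((q - e) * (e * (2 * s)))) ≤ (1 - p) * (A * (2 * e ^ 2)) := by
    refine mul_le_mul_of_nonneg_left (mul_le_mul_of_nonneg_left ?_ hA) hp1'
    have h5 := mul_le_mul_of_nonneg_left hqe he0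
    have h6 := mul_nonneg (mul_nonneg he0 he0) hs0
    linarith
  have h4 : (p * q + 2 * (1 - p) * (q * (1 - q)) + (1 - p) * q ^ 2 * (1 - s)) * (A * (1 - r)) =
      A * (p * (q - q * r) + 2 * (1 - p) * ((q - q * r) * (1 - q)) +
        (1 - p) * ((q - q * r) * (q - q * s))) := by ring
  rw [h4, hqr, hqs] at h2
  linarith

/-- The factor of `one_step_factor_le` is compensated by the growth of `m ^ ((2 - p) / 4)`. The
second-order term has the right sign because `(2 - p) ^ 2` exceeds `3 * (1 - p)`, with enough room
for the third-order term once `2 ≤ m`. -/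
theorem one_add_mul_correction_le {p m : ℝ} (hp0 : 0 ≤ p) (hp1 : p ≤ 1) (hm : 2 ≤ m) :
    (1 - (2 - p) / 4 / m + 3 * (1 - p) / (16 * m ^ 2)) * (m + 1) ^ ((2 - p) / 4) ≤
      m ^ ((2 - p) / 4) := by
  have hm0 : 0 < m := by linarith
  obtain ⟨e, he⟩ : ∃ e : ℝ, e = 1 / (4 * m) := ⟨_, rfl⟩
  have he0 : 0 ≤ e := by rw [he]; positivity
  have he1 : e ≤ 1 / 8 := by
    rw [he, div_le_div_iff₀ (by positivity) (by norm_num)]; linarith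
  have hρ : 1 - (2 - p) / 4 / m + 3 * (1 - p) / (16 * m ^ 2) =
      1 - (2 - p) * e + 3 * (1 - p) * e ^ 2 := by rw [he]; field_simp; ring
  have h1 : (m + 1) ^ ((2 - p) / 4) ≤ m ^ ((2 - p) / 4) * (1 + (2 - p) * e) := by
    have h2 := rpow_one_add_le_one_add_mul_self (s := 1 / m) (p := (2 - p) / 4)
      (by have : 0 ≤ 1 / m := by positivity
          linarith) (by linarith) (by linarith)
    have h3 : m + 1 = m * (1 + 1 / m) := by field_simp
    have h4 : (2 - p) * e = (2 - p) / 4 * (1 / m) := by rw [he]; ring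
    rw [h3, Real.mul_rpow hm0.le (by positivity), h4]
    gcongr
  have h5 : 0 ≤ 1 - (2 - p) * e + 3 * (1 - p) * e ^ 2 := by
    have h6 : 0 ≤ 3 * (1 - p) * e ^ 2 := by
      have : 0 ≤ 1 - p := by linarith
      positivity
    nlinarith
  have h7 : (1 - (2 - p) * e + 3 * (1 - p) * e ^ 2) * (1 + (2 - p) * e) ≤ 1 := by
    have h8 : 3 * (1 - p) * (1 + (2 - p) * e) ≤ (2 - p) ^ 2 := by
      have h9 : (1 - p) * ((2 - p) * e) ≤ (1 - p) * (1 / 4) :=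
        mul_le_mul_of_nonneg_left (by nlinarith) (by linarith)
      nlinarith
    nlinarith [mul_le_mul_of_nonneg_left h8 (sq_nonneg e)]
  rw [hρ]
  calc _ ≤ (1 - (2 - p) * e + 3 * (1 - p) * e ^ 2) *
        (m ^ ((2 - p) / 4) * (1 + (2 - p) * e)) := mul_le_mul_of_nonneg_left h1 h5
    _ = m ^ ((2 - p) / 4) * ((1 - (2 - p) * e + 3 * (1 - p) * e ^ 2) * (1 + (2 - p) * e)) := by
      ring
    _ ≤ m ^ ((2 - p) / 4) * 1 := by gcongr
    _ = _ := mul_one _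

/-- The potential of a vertex, normalised by a power of the number of edges, is a supermartingale. -/
theorem stepMean_potential_le (p : unitInterval) {G : Multigraph} (hG : G.NoIsolated)
    (hm : 2 ≤ G.edges.card) {v : ℕ} (hv : v < G.order) :
    stepMean p (fun H => potential (H.degree v) * (H.edges.card : ℝ) ^ ((2 - p) / 4 : ℝ)) G ≤
      potential (G.degree v) * (G.edges.card : ℝ) ^ ((2 - p) / 4 : ℝ) := by
  have hp0 : (0 : ℝ) ≤ p := p.2.1
  have hp1 : (p : ℝ) ≤ 1 := p.2.2
  have hd := hG v hv
  have hC := potential_succ_le (show 1 ≤ G.degree v + 1 by omega)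
  push_cast at hC
  have hm' : (2 : ℝ) ≤ G.edges.card := by exact_mod_cast hm
  have hA := potential_nonneg (G.degree v)
  rw [stepMean_degree p potential (fun m => (m : ℝ) ^ ((2 - p) / 4 : ℝ)) hv]
  have h1 := one_step_factor_le hp0 hp1 (show (1 : ℝ) ≤ G.degree v by exact_mod_cast hd)
    (show (0 : ℝ) < G.edges.card by linarith) (by exact_mod_cast G.degree_le hv)
    hA (potential_succ_le hd) hC
  have h2 := one_add_mul_correction_le hp0 hp1 hm'
  have h3 := mul_le_mul_of_nonneg_left h2 hA
  push_cast
  unfold Multigraph.weight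
  exact (mul_le_mul_of_nonneg_right h1 (by positivity)).trans (by rwa [mul_assoc])

/-- Among at least `2 K` vertices present at time `s`, at least `K` have degree at least `x` at time
`s + n`, up to an error. If fewer do, then more than `K` of the first `2 K` vertices have potential
at least `x ^ (-1 / 2)`, which Markov's inequality makes unlikely. As in `iterMean_initial_le`,
`f ≤ 1` stands for the conditional probability of failure in what follows. -/
theorem iterMean_le_of_many_large_degrees (p : unitInterval) {s n K : ℕ} (hs : 1 ≤ s) (hK : 1 ≤ K)
    {x : ℝ} (hx : 0 < x) {f : Multigraph → ℝ} {b : ℝ} (hb : 0 ≤ b) (hf1 : ∀ G, f G ≤ 1)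
    (hf : ∀ G : Multigraph, G.edges.card = s + n + 1 →
      ∀ S : Finset ℕ, S.card = K → (∀ v ∈ S, v < G.order ∧ x ≤ G.degree v) → f G ≤ b)
    {G : Multigraph} (hG : G.NoIsolated) (hGs : G.edges.card = s + 1) (hGK : 2 * K ≤ G.order) :
    iterMean p n f G ≤ b + 4 * √x * (((s + 1 : ℕ) : ℝ) / (s + n + 1 : ℕ)) ^ ((2 - p) / 4 : ℝ) := by
  set β : ℝ := (2 - p) / 4 with hβ
  have hK0 : (0 : ℝ) < K := by exact_mod_cast hK
  have hT : (0 : ℝ) < ((s + n + 1 : ℕ) : ℝ) ^ β := by positivity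
  -- The constant is such that `K` vertices of degree below `x` contribute at least `1`.
  set c : ℝ := √x / (K * ((s + n + 1 : ℕ) : ℝ) ^ β) with hc
  have hc0 : 0 ≤ c := by positivity
  have key := iterMean_le p
    (fun k H => H.NoIsolated ∧ H.edges.card = s + k + 1 ∧ 2 * K ≤ H.order)
    (fun _ H => b + c * ∑ v ∈ Finset.range (2 * K),
      potential (H.degree v) * (H.edges.card : ℝ) ^ β) n (f := f)
    (fun k _ H hH u => ⟨hH.1.addVertex u, by rw [H.card_edges_addVertex, hH.2.1]; omega,
      by rw [H.order_addVertex]; omega⟩)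
    (fun k _ H hH u w => ⟨hH.1.addEdge u w, by rw [H.card_edges_addEdge, hH.2.1]; omega,
      hH.2.2⟩)
    (fun k _ H hH => by
      rw [stepMean_add, stepMean_const, stepMean_const_mul, stepMean_sum]
      gcongr with v hv
      exact stepMean_potential_le p hH.1 (by omega)
        ((Finset.mem_range.1 hv).trans_le hH.2.2))
    (fun H hH => by
      obtain ⟨hH1, hH2, hH3⟩ := hH
      have hlt : ∀ v ∈ Finset.range (2 * K), v < H.order :=
        fun v hv => (Finset.mem_range.1 hv).trans_le hH3
      have hsplit := Finset.card_filter_add_card_filter_not (s := Finset.range (2 * K))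
        (fun v => x ≤ H.degree v)
      rw [Finset.card_range] at hsplit
      have hnn : ∀ v, 0 ≤ potential (H.degree v) * (H.edges.card : ℝ) ^ β :=
        fun v => mul_nonneg (potential_nonneg _) (by positivity)
      by_cases hgood : K ≤ ((Finset.range (2 * K)).filter fun v => x ≤ H.degree v).card
      · obtain ⟨S, hS, hSK⟩ := Finset.exists_subset_card_eq hgood
        have h1 := hf H hH2 S hSK fun v hv =>
          ⟨hlt v (Finset.mem_filter.1 (hS hv)).1, (Finset.mem_filter.1 (hS hv)).2⟩
        have h2 : 0 ≤ c * ∑ v ∈ Finset.range (2 * K),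
            potential (H.degree v) * (H.edges.card : ℝ) ^ β :=
          mul_nonneg hc0 (Finset.sum_nonneg fun v _ => hnn v)
        linarith
      · set B := (Finset.range (2 * K)).filter fun v => ¬ x ≤ H.degree v with hB
        have hBK : (K : ℝ) ≤ B.card := by exact_mod_cast (show K ≤ B.card by omega)
        have h1 : (K : ℝ) * ((√x)⁻¹ * ((s + n + 1 : ℕ) : ℝ) ^ β) ≤
            ∑ v ∈ Finset.range (2 * K), potential (H.degree v) * (H.edges.card : ℝ) ^ β := by
          calc _ ≤ (B.card : ℝ) * ((√x)⁻¹ * ((s + n + 1 : ℕ) : ℝ) ^ β) := by gcongr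
            _ = ∑ v ∈ B, (√x)⁻¹ * ((s + n + 1 : ℕ) : ℝ) ^ β := by
              rw [Finset.sum_const, nsmul_eq_mul]
            _ ≤ ∑ v ∈ B, potential (H.degree v) * (H.edges.card : ℝ) ^ β := by
              refine Finset.sum_le_sum fun v hv => ?_
              rw [hH2]
              have hv' := Finset.mem_filter.1 hv
              exact mul_le_mul_of_nonneg_right
                (inv_sqrt_le_potential (hH1 v (hlt v hv'.1)) (not_le.1 hv'.2).le) hT.le
            _ ≤ _ := Finset.sum_le_sum_of_subset_of_nonneg (Finset.filter_subset _ _)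
              fun v _ _ => hnn v
        have h2 := mul_le_mul_of_nonneg_left h1 hc0
        have h3 : c * (K * ((√x)⁻¹ * ((s + n + 1 : ℕ) : ℝ) ^ β)) = 1 := by
          have hx' : 0 < √x := Real.sqrt_pos.2 hx
          rw [hc]; field_simp
        linarith [hf1 H])
    (G := G) ⟨hG, hGs, hGK⟩
  refine key.trans ?_
  have h1 : ∑ v ∈ Finset.range (2 * K), potential (G.degree v) * (G.edges.card : ℝ) ^ β ≤
      (2 * K : ℕ) • (2 * ((s + 1 : ℕ) : ℝ) ^ β) := by
    refine (Finset.sum_le_card_nsmul _ _ _ fun v hv => ?_).trans_eq (by rw [Finset.card_range])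
    rw [hGs]
    exact mul_le_mul_of_nonneg_right
      (potential_le_two (hG v ((Finset.mem_range.1 hv).trans_le hGK))) (by positivity)
  have h2 := mul_le_mul_of_nonneg_left h1 hc0
  have h3 : c * ((2 * K : ℕ) • (2 * ((s + 1 : ℕ) : ℝ) ^ β)) =
      4 * √x * (((s + 1 : ℕ) : ℝ) / (s + n + 1 : ℕ)) ^ β := by
    rw [Real.div_rpow (by positivity) (by positivity), hc, nsmul_eq_mul]
    push_cast
    push_cast at hT
    field_simp
    norm_num
  linarith

/-! ### Vertices of large degree form a clique -/

open Classical in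
/-- The indicator that `u` and `w` are distinct and not joined by an edge. -/
noncomputable def nonAdj (u w : ℕ) (G : Multigraph) : ℝ :=
  if u = w ∨ s(u, w) ∈ G.edges then 0 else 1

theorem nonAdj_nonneg (u w : ℕ) (G : Multigraph) : 0 ≤ nonAdj u w G := by
  unfold nonAdj; split_ifs <;> norm_num

theorem nonAdj_le_one (u w : ℕ) (G : Multigraph) : nonAdj u w G ≤ 1 := by
  unfold nonAdj; split_ifs <;> norm_num

/-- Only the event that an edge-step draws `u` first and `w` second is used. -/
theorem stepMean_nonAdj_le (p : unitInterval) {G : Multigraph} {u w : ℕ} (hu : u < G.order)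
    (hw : w < G.order) :
    stepMean p (nonAdj u w) G ≤ (1 - (1 - p) * (G.weight u * G.weight w)) * nonAdj u w G := by
  by_cases h : u = w ∨ s(u, w) ∈ G.edges
  · have h1 : ∀ e : Sym2 ℕ, u = w ∨ s(u, w) ∈ e ::ₘ G.edges :=
      fun e => h.imp_right Multiset.mem_cons_of_mem
    have h2 : stepMean p (nonAdj u w) G ≤ stepMean p (fun _ => 0) G :=
      stepMean_mono p (fun a => (if_pos (h1 _)).le) fun a b => (if_pos (h1 _)).le
    rw [stepMean_const] at h2
    rwa [nonAdj, if_pos h, mul_zero]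
  · have hp1 : (0 : ℝ) ≤ 1 - p := sub_nonneg.2 p.2.2
    have hp0 : (0 : ℝ) ≤ p := p.2.1
    have hq := G.weight_nonneg
    have h1 : ∑ a : Fin G.order, G.weight a * nonAdj u w (G.addVertex a) ≤ 1 := by
      rw [← G.sum_weight]
      exact Finset.sum_le_sum fun a _ => mul_le_of_le_one_right (hq _) (nonAdj_le_one _ _ _)
    have h2 : ∑ a : Fin G.order, G.weight a * ∑ b : Fin G.order, G.weight b *
        nonAdj u w (G.addEdge a b) ≤ 1 - G.weight u * G.weight w := by
      calc _ ≤ ∑ a : Fin G.order, G.weight a * (if (a : ℕ) = u then 1 - G.weight w else 1) := by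
            refine Finset.sum_le_sum fun a _ => mul_le_mul_of_nonneg_left ?_ (hq _)
            split_ifs with ha
            · calc _ ≤ ∑ b : Fin G.order, G.weight b * (if (b : ℕ) = w then 0 else 1) := by
                    refine Finset.sum_le_sum fun b _ => mul_le_mul_of_nonneg_left ?_ (hq _)
                    split_ifs with hb
                    · refine (if_pos (Or.inr ?_)).le
                      rw [← ha, ← hb]
                      exact Multiset.mem_cons_self _ _
                    · exact nonAdj_le_one _ _ _
                _ = 1 - G.weight w := by rw [G.sum_weight_mul_ite hw]; ring
            · rw [← G.sum_weight]
              exact Finset.sum_le_sum fun b _ =>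
                mul_le_of_le_one_right (hq _) (nonAdj_le_one _ _ _)
        _ = _ := by rw [G.sum_weight_mul_ite hu]; ring
    rw [nonAdj, if_neg h, mul_one, stepMean]
    have h3 := mul_le_mul_of_nonneg_left h1 hp0
    have h4 := mul_le_mul_of_nonneg_left h2 hp1
    linarith

open Classical in
/-- The indicator that `G` has no complete subgraph of order `K`. -/
noncomputable def noClique (K : ℕ) (G : Multigraph) : ℝ :=
  if G.HasCompleteSubgraph K then 0 else 1

theorem noClique_le_one (K : ℕ) (G : Multigraph) : noClique K G ≤ 1 := by
  unfold noClique; split_ifs <;> norm_num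

theorem noClique_nonneg (K : ℕ) (G : Multigraph) : 0 ≤ noClique K G := by
  unfold noClique; split_ifs <;> norm_num

theorem hasCompleteSubgraph_of_forall {G : Multigraph} {S : Finset ℕ} (hS : ∀ v ∈ S, v < G.order)
    (h : ∀ u ∈ S, ∀ w ∈ S, u ≠ w → s(u, w) ∈ G.edges) : G.HasCompleteSubgraph S.card := by
  refine ⟨S.attachFin hS, ?_, S.card_attachFin hS⟩
  intro u hu w hw huw
  rw [Finset.mem_coe, Finset.mem_attachFin] at hu hw
  exact ⟨huw, h u hu w hw fun e => huw (Fin.ext e)⟩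

theorem noClique_le_sum_nonAdj {G : Multigraph} {S : Finset ℕ} (hS : ∀ v ∈ S, v < G.order) :
    noClique S.card G ≤ ∑ u ∈ S, ∑ w ∈ S, nonAdj u w G := by
  by_cases h : G.HasCompleteSubgraph S.card
  · rw [noClique, if_pos h]
    exact Finset.sum_nonneg fun u _ => Finset.sum_nonneg fun w _ => nonAdj_nonneg u w G
  · have h1 := mt (hasCompleteSubgraph_of_forall hS) h
    push Not at h1
    obtain ⟨u, hu, w, hw, huw, hn⟩ := h1
    calc noClique S.card G ≤ 1 := noClique_le_one _ _
      _ = nonAdj u w G := by rw [nonAdj, if_neg (by tauto)]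
      _ ≤ ∑ w ∈ S, nonAdj u w G :=
        Finset.single_le_sum (f := fun w => nonAdj u w G) (fun w _ => nonAdj_nonneg u w G) hw
      _ ≤ _ := Finset.single_le_sum (f := fun u => ∑ w ∈ S, nonAdj u w G)
        (fun u _ => Finset.sum_nonneg fun w _ => nonAdj_nonneg u w G) hu

/-- A set of vertices of degree at least `x` at time `t` spans a complete graph at time `2 * t`, up to an
error: degrees never decrease and there are at most `2 * t` edges before each of these steps, so that
two given vertices are joined with probability at least `(1 - p) * (x / (4 * t)) ^ 2`. -/
theorem iterMean_noClique_le (p : unitInterval) {t : ℕ} (ht : 1 ≤ t) {x : ℝ} (hx : 0 ≤ x)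
    (hxt : x ≤ 4 * t) {G : Multigraph} (hG : G.edges.card = t + 1) {S : Finset ℕ}
    (hS : ∀ v ∈ S, v < G.order ∧ x ≤ G.degree v) :
    iterMean p t (noClique S.card) G ≤
      (S.card : ℝ) ^ 2 * (1 - (1 - p) * (x / (4 * t)) ^ 2) ^ t := by
  have ht0 : (0 : ℝ) < t := by exact_mod_cast ht
  have hp1 : (0 : ℝ) ≤ 1 - p := sub_nonneg.2 p.2.2
  have hp0 : (0 : ℝ) ≤ p := p.2.1
  set r : ℝ := 1 - (1 - p) * (x / (4 * t)) ^ 2 with hr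
  have hr0 : 0 ≤ r := by
    have h1 : (x / (4 * t)) ^ 2 ≤ 1 :=
      pow_le_one₀ (by positivity) ((div_le_one (by positivity)).2 hxt)
    nlinarith
  have key := iterMean_le p
    (fun k H => H.edges.card = t + k + 1 ∧ ∀ v ∈ S, v < H.order ∧ x ≤ H.degree v)
    (fun k H => r ^ (t - k) * ∑ u ∈ S, ∑ w ∈ S, nonAdj u w H) t (f := noClique S.card)
    (fun k _ H hH u => ⟨by rw [H.card_edges_addVertex, hH.1]; omega, fun v hv =>
      ⟨by rw [H.order_addVertex]; exact (hH.2 v hv).1.trans (Nat.lt_succ_self _), by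
        rw [H.degree_addVertex]
        exact (hH.2 v hv).2.trans (by exact_mod_cast Nat.le_add_right _ _)⟩⟩)
    (fun k _ H hH u w => ⟨by rw [H.card_edges_addEdge, hH.1]; omega, fun v hv =>
      ⟨(hH.2 v hv).1, by
        rw [H.degree_addEdge]
        exact (hH.2 v hv).2.trans (by exact_mod_cast Nat.le_add_right _ _)⟩⟩)
    (fun k hk H hH => by
      simp only [stepMean_const_mul, stepMean_sum]
      rw [show t - k = t - (k + 1) + 1 by omega, pow_succ, mul_assoc]
      refine mul_le_mul_of_nonneg_left ?_ (pow_nonneg hr0 _)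
      rw [Finset.mul_sum]
      refine Finset.sum_le_sum fun u hu => ?_
      rw [Finset.mul_sum]
      refine Finset.sum_le_sum fun w hw => ?_
      refine (stepMean_nonAdj_le p (hH.2 u hu).1 (hH.2 w hw).1).trans
        (mul_le_mul_of_nonneg_right ?_ (nonAdj_nonneg u w H))
      have hcard : (H.edges.card : ℝ) ≤ 2 * t := by
        rw [hH.1]; exact_mod_cast (show t + k + 1 ≤ 2 * t by omega)
      have hpos : (0 : ℝ) < H.edges.card := by exact_mod_cast H.card_edges_pos
      have hwt : ∀ v ∈ S, x / (4 * t) ≤ H.weight v := fun v hv => by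
        unfold Multigraph.weight
        exact div_le_div₀ (Nat.cast_nonneg _) (hH.2 v hv).2 (by positivity) (by linarith)
      have := mul_le_mul (hwt u hu) (hwt w hw) (by positivity) (H.weight_nonneg u)
      rw [hr, sq]
      have := mul_le_mul_of_nonneg_left this hp1
      linarith)
    (fun H hH => by
      rw [Nat.sub_self, pow_zero, one_mul]
      exact noClique_le_sum_nonAdj fun v hv => (hH.2 v hv).1)
    (G := G) ⟨hG, hS⟩
  refine key.trans ?_
  rw [Nat.sub_zero, mul_comm]
  refine mul_le_mul_of_nonneg_right ?_ (pow_nonneg hr0 _)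
  calc ∑ u ∈ S, ∑ w ∈ S, nonAdj u w G ≤ ∑ u ∈ S, ∑ w ∈ S, (1 : ℝ) :=
        Finset.sum_le_sum fun u _ => Finset.sum_le_sum fun w _ => nonAdj_le_one u w G
    _ = (S.card : ℝ) ^ 2 := by simp [sq]

/-- The three phases combined: a bound for the probability that `G_{2t}` has no complete subgraph of
order `K`. The intermediate time `s` and the degree threshold `x` are free parameters. -/
theorem iterMean_noClique_initial_le (p : unitInterval) {s t K : ℕ} (hs : 1 ≤ s) (hst : s ≤ t)
    (hK : 1 ≤ K) {x : ℝ} (hx : 0 < x) (hxt : x ≤ 4 * t) :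
    iterMean p (2 * t) (noClique K) Multigraph.initial ≤
      (K : ℝ) ^ 2 * (1 - (1 - p) * (x / (4 * t)) ^ 2) ^ t +
        4 * √x * (((s + 1 : ℕ) : ℝ) / (t + 1 : ℕ)) ^ ((2 - p) / 4 : ℝ) +
        2 ^ (2 * K) * (1 - p / 2) ^ s := by
  have ht0 : (0 : ℝ) < t := by exact_mod_cast (show 0 < t by omega)
  have hp1 : (0 : ℝ) ≤ 1 - p := sub_nonneg.2 p.2.2
  have hp0 : (0 : ℝ) ≤ p := p.2.1
  have hr0 : (0 : ℝ) ≤ 1 - (1 - p) * (x / (4 * t)) ^ 2 := by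
    have h1 : (x / (4 * t)) ^ 2 ≤ 1 :=
      pow_le_one₀ (by positivity) ((div_le_one (by positivity)).2 hxt)
    nlinarith
  obtain ⟨n, rfl⟩ := Nat.exists_eq_add_of_le hst
  rw [show 2 * (s + n) = s + (n + (s + n)) by ring, iterMean_add, iterMean_add]
  have hle := iterMean_le_const p (s + n) (noClique_le_one K)
  refine iterMean_initial_le p s (2 * K) (by positivity) (iterMean_le_const p n hle) ?_
  intro G hG hGs hGK
  refine iterMean_le_of_many_large_degrees p hs hK hx (by positivity) hle ?_ hG hGs hGK
  rintro H hH S rfl hS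
  exact iterMean_noClique_le p (by omega) hx.le hxt hH hS

theorem glpLaw_hasCompleteSubgraph (p : unitInterval) (n K : ℕ) :
    glpLaw p {G : ℕ → Multigraph | (G n).HasCompleteSubgraph K} =
      1 - ENNReal.ofReal (iterMean p n (noClique K) Multigraph.initial) := by
  set A : Set (ℕ → Multigraph) := {G | (G n).HasCompleteSubgraph K} with hA
  have hm : MeasurableSet A :=
    (show Measurable fun G : ℕ → Multigraph => G n from measurable_pi_apply n)
      (MeasurableSet.of_discrete (s := {H : Multigraph | H.HasCompleteSubgraph K}))
  have h : ∫⁻ G, ENNReal.ofReal (noClique K (G n)) ∂glpLaw p = glpLaw p Aᶜ := by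
    rw [← lintegral_indicator_one hm.compl]
    refine lintegral_congr fun G => ?_
    by_cases hG : (G n).HasCompleteSubgraph K
    · rw [noClique, if_pos hG, Set.indicator_of_notMem (show G ∉ Aᶜ from fun hc => hc hG),
        ENNReal.ofReal_zero]
    · rw [noClique, if_neg hG, Set.indicator_of_mem (show G ∈ Aᶜ from hG), ENNReal.ofReal_one,
        Pi.one_apply]
  rw [← lintegral_glpLaw p n (noClique_nonneg K), h, ← prob_compl_eq_one_sub hm.compl, compl_compl]

theorem noClique_one (G : Multigraph) : noClique 1 G = 0 := by
  obtain ⟨v, -⟩ := G.exists_degree_ne_zero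
  refine if_pos (hasCompleteSubgraph_of_forall (S := {(v : ℕ)}) ?_ ?_)
  · intro u hu
    rw [Finset.mem_singleton.1 hu]
    exact v.2
  · intro u hu w hw huw
    exact absurd ((Finset.mem_singleton.1 hu).trans (Finset.mem_singleton.1 hw).symm) huw

/-! ### Asymptotics of the error terms -/

theorem tendsto_natCast_rpow_atTop {c : ℝ} (hc : 0 < c) :
    Tendsto (fun t : ℕ => (t : ℝ) ^ c) atTop atTop :=
  (tendsto_rpow_atTop hc).comp tendsto_natCast_atTop_atTop

theorem natCeil_rpow_le {t : ℕ} (ht : 1 ≤ t) (κ : ℝ) : (⌈(t : ℝ) ^ κ⌉₊ : ℝ) ≤ (t : ℝ) ^ κ + 1 :=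
  (Nat.ceil_lt_add_one (by positivity)).le

/-- The error term of the last phase. It is at most a constant times
`t ^ 2 * exp (-(c / 16) * t ^ (2 * δ))`. -/
theorem tendsto_sq_mul_one_sub_pow {c κ δ : ℝ} (hc : 0 < c) (hc1 : c ≤ 1) (hκ : κ ≤ 1)
    (hδ : 0 < δ) (hδ1 : δ ≤ 1 / 2) :
    Tendsto (fun t : ℕ => (⌈(t : ℝ) ^ κ⌉₊ : ℝ) ^ 2 *
      (1 - c * ((t : ℝ) ^ (1 / 2 + δ) / (4 * t)) ^ 2) ^ t) atTop (𝓝 0) := by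
  have hlim : Tendsto (fun t : ℕ => 4 * (((t : ℝ) ^ (2 * δ)) ^ (1 / δ) *
      Real.exp (-(c / 16) * (t : ℝ) ^ (2 * δ)))) atTop (𝓝 0) := by
    have h := (tendsto_rpow_mul_exp_neg_mul_atTop_nhds_zero (1 / δ) (c / 16) (by positivity)).comp
      (tendsto_natCast_rpow_atTop (c := 2 * δ) (by positivity))
    simpa using h.const_mul 4
  have hev : ∀ᶠ t : ℕ in atTop, 0 ≤ (1 - c * ((t : ℝ) ^ (1 / 2 + δ) / (4 * t)) ^ 2) ∧
      (⌈(t : ℝ) ^ κ⌉₊ : ℝ) ^ 2 * (1 - c * ((t : ℝ) ^ (1 / 2 + δ) / (4 * t)) ^ 2) ^ t ≤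
      4 * (((t : ℝ) ^ (2 * δ)) ^ (1 / δ) * Real.exp (-(c / 16) * (t : ℝ) ^ (2 * δ))) := by
    filter_upwards [eventually_ge_atTop 1] with t ht
    have ht1 : (1 : ℝ) ≤ t := by exact_mod_cast ht
    have ht0 : (0 : ℝ) < t := by linarith
    have h1 : c * ((t : ℝ) ^ (1 / 2 + δ) / (4 * t)) ^ 2 = c / 16 * (t : ℝ) ^ (2 * δ - 1) := by
      rw [div_pow, mul_pow, ← Real.rpow_natCast ((t : ℝ) ^ (1 / 2 + δ)), ← Real.rpow_mul ht0.le,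
        Real.rpow_sub_one ht0.ne',
        show (1 / 2 + δ) * ((2 : ℕ) : ℝ) = 2 * δ + 1 by push_cast; ring, Real.rpow_add_one ht0.ne']
      field_simp
      norm_num
    have h2 : (t : ℝ) ^ (2 * δ - 1) ≤ 1 := Real.rpow_le_one_of_one_le_of_nonpos ht1 (by linarith)
    have h3 : 0 ≤ (t : ℝ) ^ (2 * δ - 1) := by positivity
    have h4 : 0 ≤ 1 - c / 16 * (t : ℝ) ^ (2 * δ - 1) := by nlinarith
    rw [h1]
    refine ⟨h4, ?_⟩
    have hK : (⌈(t : ℝ) ^ κ⌉₊ : ℝ) ≤ 2 * t := by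
      have := natCeil_rpow_le ht κ
      have h5 : (t : ℝ) ^ κ ≤ (t : ℝ) ^ (1 : ℝ) := Real.rpow_le_rpow_of_exponent_le ht1 hκ
      rw [Real.rpow_one] at h5
      linarith
    have hexp : (1 - c / 16 * (t : ℝ) ^ (2 * δ - 1)) ^ t ≤
        Real.exp (-(c / 16) * (t : ℝ) ^ (2 * δ)) := by
      calc _ ≤ Real.exp (-(c / 16 * (t : ℝ) ^ (2 * δ - 1))) ^ t :=
            pow_le_pow_left₀ h4 (Real.one_sub_le_exp_neg _) _
        _ = _ := by
          rw [← Real.exp_nat_mul, Real.rpow_sub_one ht0.ne']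
          congr 1
          field_simp
    have ht2 : ((t : ℝ) ^ (2 * δ)) ^ (1 / δ) = (t : ℝ) ^ 2 := by
      rw [← Real.rpow_mul ht0.le, show 2 * δ * (1 / δ) = ((2 : ℕ) : ℝ) by push_cast; field_simp,
        Real.rpow_natCast]
    rw [ht2]
    calc _ ≤ (2 * (t : ℝ)) ^ 2 * Real.exp (-(c / 16) * (t : ℝ) ^ (2 * δ)) := by gcongr
      _ = _ := by ring
  exact squeeze_zero' (hev.mono fun t h => mul_nonneg (by positivity) (pow_nonneg h.1 _))
    (hev.mono fun t h => h.2) hlim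

/-- The error term of the middle phase. -/
theorem tendsto_sqrt_mul_ratio_rpow {α σ β : ℝ} (hσ : 0 ≤ σ) (hβ : 0 ≤ β) (hβ1 : β ≤ 1)
    (hneg : α / 2 + (σ - 1) * β < 0) :
    Tendsto (fun t : ℕ => 4 * √((t : ℝ) ^ α) *
      (((⌊(t : ℝ) ^ σ⌋₊ + 1 : ℕ) : ℝ) / (t + 1 : ℕ)) ^ β) atTop (𝓝 0) := by
  have hlim : Tendsto (fun t : ℕ => 8 * (t : ℝ) ^ (α / 2 + (σ - 1) * β)) atTop (𝓝 0) := by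
    have h := (tendsto_rpow_neg_atTop (neg_pos.2 hneg)).comp (tendsto_natCast_atTop_atTop (R := ℝ))
    simpa using h.const_mul 8
  refine squeeze_zero' (Eventually.of_forall fun t => by positivity) ?_ hlim
  filter_upwards [eventually_ge_atTop 1] with t ht
  have ht1 : (1 : ℝ) ≤ t := by exact_mod_cast ht
  have ht0 : (0 : ℝ) < t := by linarith
  have h1 : ((⌊(t : ℝ) ^ σ⌋₊ + 1 : ℕ) : ℝ) / (t + 1 : ℕ) ≤ 2 * (t : ℝ) ^ (σ - 1) := by
    have h2 := Nat.floor_le (show 0 ≤ (t : ℝ) ^ σ by positivity)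
    have h3 := Real.one_le_rpow ht1 hσ
    rw [Real.rpow_sub_one ht0.ne', ← mul_div_assoc]
    push_cast
    exact div_le_div₀ (by positivity) (by linarith) ht0 (by linarith)
  have h4 : (2 : ℝ) ^ β ≤ 2 := Real.rpow_le_self_of_one_le (by norm_num) hβ1
  calc _ ≤ 4 * √((t : ℝ) ^ α) * (2 * (t : ℝ) ^ (σ - 1)) ^ β := by gcongr
    _ = 4 * 2 ^ β * (t : ℝ) ^ (α / 2 + (σ - 1) * β) := by
      rw [Real.mul_rpow two_pos.le (by positivity), ← Real.rpow_mul ht0.le, Real.sqrt_eq_rpow,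
        ← Real.rpow_mul ht0.le, Real.rpow_add ht0]
      ring_nf
    _ ≤ _ := by
      have : 0 ≤ (t : ℝ) ^ (α / 2 + (σ - 1) * β) := by positivity
      nlinarith

/-- The error term of the first phase. -/
theorem tendsto_two_pow_mul_pow {p κ σ : ℝ} (hp0 : 0 < p) (hp1 : p ≤ 1) (hκσ : κ < σ)
    (hσ : 0 < σ) :
    Tendsto (fun t : ℕ => (2 : ℝ) ^ (2 * ⌈(t : ℝ) ^ κ⌉₊) * (1 - p / 2) ^ ⌊(t : ℝ) ^ σ⌋₊)
      atTop (𝓝 0) := by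
  have hlim : Tendsto (fun t : ℕ => Real.exp (3 - p / 4 * (t : ℝ) ^ σ)) atTop (𝓝 0) := by
    refine Real.tendsto_exp_atBot.comp (tendsto_atBot_add_const_left _ 3
      (tendsto_neg_atTop_atBot.comp ?_))
    exact (tendsto_natCast_rpow_atTop hσ).const_mul_atTop (by positivity)
  have hsmall : ∀ᶠ t : ℕ in atTop, (t : ℝ) ^ (-(σ - κ)) < p / 8 :=
    ((tendsto_rpow_neg_atTop (sub_pos.2 hκσ)).comp (tendsto_natCast_atTop_atTop (R := ℝ))).eventually
      (gt_mem_nhds (by positivity))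
  refine squeeze_zero' (Eventually.of_forall fun t => ?_) ?_ hlim
  · exact mul_nonneg (by positivity) (pow_nonneg (by linarith) _)
  filter_upwards [eventually_ge_atTop 1, hsmall] with t ht hts
  have ht1 : (1 : ℝ) ≤ t := by exact_mod_cast ht
  have ht0 : (0 : ℝ) < t := by linarith
  have hκ : (t : ℝ) ^ κ ≤ p / 8 * (t : ℝ) ^ σ := by
    have : (t : ℝ) ^ κ = (t : ℝ) ^ (-(σ - κ)) * (t : ℝ) ^ σ := by
      rw [← Real.rpow_add ht0]; congr 1; ring
    rw [this]
    gcongr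
  have hK := natCeil_rpow_le ht κ
  have hs := Nat.lt_floor_add_one ((t : ℝ) ^ σ)
  have h2 : (2 : ℝ) ≤ Real.exp 1 := by linarith [Real.add_one_le_exp (1 : ℝ)]
  have h3 : (1 - p / 2 : ℝ) ≤ Real.exp (-(p / 2)) := Real.one_sub_le_exp_neg _
  calc _ ≤ Real.exp 1 ^ (2 * ⌈(t : ℝ) ^ κ⌉₊) * Real.exp (-(p / 2)) ^ ⌊(t : ℝ) ^ σ⌋₊ := by
        have h4 : (0 : ℝ) ≤ 1 - p / 2 := by linarith
        gcongr
    _ = Real.exp (2 * ⌈(t : ℝ) ^ κ⌉₊ - p / 2 * ⌊(t : ℝ) ^ σ⌋₊) := by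
      rw [← Real.exp_nat_mul, ← Real.exp_nat_mul, ← Real.exp_add]
      congr 1
      push_cast
      ring
    _ ≤ _ := by
      apply Real.exp_le_exp.2
      have := mul_le_mul_of_nonneg_left hs.le (show 0 ≤ p / 2 by positivity)
      linarith

/-- The probability that `G_{2t}` lacks the clique tends to `0`. -/
theorem tendsto_iterMean_noClique (p : unitInterval) (hp : 0 < p) {ε : ℝ} (hε : 0 < ε) :
    Tendsto (fun t : ℕ => iterMean p (2 * t)
      (noClique ⌈(t : ℝ) ^ ((1 - ε) * ((1 - p) / (2 - p)) : ℝ)⌉₊) Multigraph.initial)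
      atTop (𝓝 0) := by
  have hp0 : (0 : ℝ) < p := hp
  have hp1 : (p : ℝ) ≤ 1 := p.2.2
  have hnn : ∀ n K, 0 ≤ iterMean p n (noClique K) Multigraph.initial := fun n K =>
    iterMean_nonneg p n (noClique_nonneg K) _
  set a : ℝ := (1 - p) / (2 - p) with ha
  have ha0 : 0 ≤ a := div_nonneg (by linarith) (by linarith)
  by_cases hκ0 : (1 - ε) * a ≤ 0
  · refine tendsto_const_nhds.congr' ?_
    filter_upwards [eventually_ge_atTop 1] with t ht
    have ht1 : (1 : ℝ) ≤ t := by exact_mod_cast ht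
    have hK : ⌈(t : ℝ) ^ ((1 - ε) * a)⌉₊ = 1 := by
      refine le_antisymm (Nat.ceil_le.2 ?_) (Nat.ceil_pos.2 (by positivity))
      simpa using Real.rpow_le_one_of_one_le_of_nonpos ht1 hκ0
    rw [hK]
    exact le_antisymm (hnn _ _) (iterMean_le_const p _ (fun G => (noClique_one G).le) _)
  · have hp1' : (p : ℝ) < 1 := by
      by_contra h
      exact hκ0 (by rw [ha, show (p : ℝ) = 1 by linarith]; simp)
    have ha1 : a ≤ 1 := (div_le_one (by linarith)).2 (by linarith)
    have hapos : 0 < a := div_pos (by linarith) (by linarith)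
    have hε1 : ε < 1 := by
      by_contra h
      exact hκ0 (mul_nonpos_of_nonpos_of_nonneg (by linarith) ha0)
    set κ : ℝ := (1 - ε) * a with hκ
    set σ : ℝ := (1 - ε / 2) * a with hσ
    -- With this `δ`, the error term of the middle phase is of order `t ^ (-ε * (1 - p) / 16)`.
    set δ : ℝ := ε * (1 - p) / 8 with hδ
    have hκσ : κ < σ := mul_lt_mul_of_pos_right (by linarith) hapos
    have hσ0 : 0 < σ := mul_pos (by linarith) hapos
    have hσ1 : σ ≤ 1 := mul_le_one₀ (by linarith) ha0 ha1
    have hδ0 : 0 < δ := div_pos (mul_pos hε (by linarith)) (by norm_num)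
    have hδ1 : δ ≤ 1 / 2 := by
      have : ε * (1 - p) ≤ 1 := mul_le_one₀ hε1.le (by linarith) (by linarith)
      rw [hδ]; linarith
    have hneg : (1 / 2 + δ) / 2 + (σ - 1) * ((2 - p) / 4) < 0 := by
      have h1 : a * (2 - p) = 1 - p := div_mul_cancel₀ _ (by linarith)
      have h2 : (1 / 2 + δ) / 2 + (σ - 1) * ((2 - p) / 4) = - (ε * (1 - p) / 16) := by
        rw [show (σ - 1) * ((2 - p) / 4) = ((1 - ε / 2) * (a * (2 - p)) - (2 - p)) / 4 by
          rw [hσ]; ring, h1, hδ]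
        ring
      rw [h2]
      have : 0 < ε * (1 - p) := mul_pos hε (by linarith)
      linarith
    have hlim := ((tendsto_sq_mul_one_sub_pow (c := 1 - p) (κ := κ) (by linarith) (by linarith)
      (by linarith) hδ0 hδ1).add (tendsto_sqrt_mul_ratio_rpow (α := 1 / 2 + δ) hσ0.le
        (by linarith) (by linarith) hneg)).add (tendsto_two_pow_mul_pow hp0 hp1 hκσ hσ0)
    rw [add_zero, add_zero] at hlim
    refine squeeze_zero' (Eventually.of_forall fun t => hnn _ _) ?_ hlim
    filter_upwards [eventually_ge_atTop 1] with t ht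
    have ht1 : (1 : ℝ) ≤ t := by exact_mod_cast ht
    refine iterMean_noClique_initial_le p ?_ ?_ (Nat.ceil_pos.2 (by positivity)) (by positivity) ?_
    · exact Nat.le_floor (by simpa using Real.one_le_rpow ht1 hσ0.le)
    · refine Nat.floor_le_of_le ?_
      simpa using Real.rpow_le_rpow_of_exponent_le ht1 hσ1
    · have := Real.rpow_le_rpow_of_exponent_le ht1 (show 1 / 2 + δ ≤ 1 by linarith)
      rw [Real.rpow_one] at this
      linarith

theorem theorem1 (p : unitInterval) (hp : 0 < p) (ε : ℝ) (hε : 0 < ε) :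
    Tendsto
      (fun t : ℕ => glpLaw p {G : ℕ → Multigraph |
        (G (2 * t)).HasCompleteSubgraph ⌈(t : ℝ) ^ ((1 - ε) * ((1 - p) / (2 - p)) : ℝ)⌉₊})
      atTop (𝓝 1) := by
  simp only [glpLaw_hasCompleteSubgraph]
  have h := ENNReal.tendsto_ofReal (tendsto_iterMean_noClique p hp hε)
  simpa using ENNReal.Tendsto.sub tendsto_const_nhds h (Or.inl ENNReal.one_ne_top)
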